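/- Let $G=(V,E)$ be a finite undirected graph (loops and multi-edges allowed, so cycles of length one and two are possible), let $S\subseteq E$ and $k\in\mathbb N$, and let $T=V(S)$ be the set of endpoints of edges in $S$. A \emph{solution} for $(G,S,k)$ is a set $X\subseteq V$ with $|X|\le k$ that intersects every cycle of $G$ containing at least one edge of $S$. A solution is \emph{dominant} if it has minimum size among all solutions and contains the maximum number of vertices of $T$ among the solutions of minimum size. In a graph with directed and undirected edges, a vertex set $B$ is \emph{linked} to a vertex set $A$ if there are $|B|$ vertex-disjoint paths from $A$ to $B$ (paths of length zero allowed). The \emph{gammoid} with sources $A$ and ground set $U$ is the matroid on $U$ whose independent sets are the subsets of $U$ that are linked to $A$. Let $G_1$ be obtained from $G-S$ by adding, for every $v\in V$, two new vertices $v',v''$ with directed edges $(u,v'),(u,v'')$ for each edge $\{u,v\}$ of $G-S$. Let $M_1$ be the gammoid on $G_1$ with sources $T$ and ground set $\{v,v',v''\mid v\in V\}$. Let $M_2$ be the gammoid on the complete bipartite digraph with all edges directed from a set $S_2$ of $k$ vertices to $\hat V=\{\hat v\mid v\in V\}$, with sources $S_2$ and ground set $\hat V$. Let $M=M_1\oplus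 M_2$ be the direct sum and let $\mathcal T=\{\{v',v'',\hat v\}\mid v\in V\}$. A set $A$ \emph{extends} a set $B$ in $M$ if $A\cap B=\emptyset$ and $A\cup B$ is independent in $M$; a set $A\in\mathcal T$ \emph{uniquely extends} $I$ if $A$ extends $I$ and no other member of $\mathcal T$ extends $I$. A family $\mathcal T'\subseteq\mathcal T$ is \emph{$q$-representative} for $\mathcal T$ if for every independent set $B$ of $M$ with $|B|\le q$, some member of $\mathcal T$ extends $B$ if and only if some member of $\mathcal T'$ extends $B$. \textbf{Lemma.} Let $X$ be a dominant solution for $(G,S,k)$ and let $x\in X_0=X\setminus T$. Then there exists an independent set $I$ of $M$ with $|I|\le |T|+k-3$ such that $\{x',x'',\hat x\}$ uniquely extends $I$. Consequently, every $(|T|+k-3)$-representative family $\mathcal T'\subseteq\mathcal T$ for $\mathcal T$ contains $\{x',x'',\hat x\}$. -/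

import Mathlib

open scoped Graph

namespace SubsetFVS

/-! ### Linked sets and gammoids

A graph with directed and undirected edges is encoded as a `Digraph`, an undirected edge being a
pair of opposite arcs. -/

section Gammoid

variable {W : Type*}

/-- `p` lists the vertices of a directed path from `s` to `t`; the path may have length zero. -/
structure IsDirPath (D : Digraph W) (p : List W) (s t : W) : Prop where
  chain : p.IsChain D.Adj
  nodup : p.Nodup
  head : p.head? = some s
  last : p.getLast? = some t

/-- `T` is linked to `S`: there are `|T|` vertex-disjoint paths from `S` to `T`, one ending in each
vertex of `T`. -/
def IsLinked (D : Digraph W) (S T : Set W) : Prop :=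
  ∃ p : W → List W,
    (∀ t ∈ T, ∃ s ∈ S, IsDirPath D (p t) s t) ∧
    (∀ t ∈ T, ∀ t' ∈ T, t ≠ t' → (p t).Disjoint (p t'))

theorem isLinked_empty (D : Digraph W) (S : Set W) : IsLinked D S ∅ :=
  ⟨fun _ => [], by simp, by simp⟩

theorem IsLinked.subset {D : Digraph W} {S T T' : Set W} (h : IsLinked D S T) (hT : T' ⊆ T) :
    IsLinked D S T' := by
  obtain ⟨p, h1, h2⟩ := h
  exact ⟨p, fun t ht => h1 t (hT ht), fun t ht t' ht' => h2 t (hT ht) t' (hT ht')⟩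

/-- A system of disjoint paths from `S` to `T` gives an injection of the complement of `S` into the
complement of `T` that moves each vertex to itself or to a predecessor. -/
theorem IsLinked.exists_matching {D : Digraph W} {S T : Set W} (h : IsLinked D S T) :
    ∃ f : W → W, Set.InjOn f Sᶜ ∧ (∀ v ∈ Sᶜ, f v ∉ T) ∧ ∀ v ∈ Sᶜ, f v = v ∨ D.Adj (f v) v := by
  classical
  obtain ⟨p, hp, hd⟩ := h
  have hex : ∀ v, ∃ u, v ∈ Sᶜ →
      (u = v ∧ ∀ t ∈ T, v ∉ p t) ∨
      (∃ t ∈ T, ∃ i, ∃ hi : i + 1 < (p t).length, u = (p t)[i] ∧ v = (p t)[i + 1]) := by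
    intro v
    by_cases hv : ∃ t ∈ T, v ∈ p t
    · obtain ⟨t, ht, hvt⟩ := hv
      obtain ⟨j, hj, rfl⟩ := List.getElem_of_mem hvt
      rcases j with _ | j
      · refine ⟨(p t)[0], fun hv => ?_⟩
        obtain ⟨s, hs, hP⟩ := hp t ht
        have := hP.head
        rw [List.head?_eq_getElem?, List.getElem?_eq_getElem hj] at this
        simp only [Option.some.injEq] at this
        exact absurd (this ▸ hs) hv
      · exact ⟨(p t)[j], fun _ => Or.inr ⟨t, ht, j, hj, rfl, rfl⟩⟩
    · push Not at hv
      exact ⟨v, fun _ => Or.inl ⟨rfl, hv⟩⟩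
  choose f hf using hex
  refine ⟨f, ?_, ?_, ?_⟩
  · intro v hv v' hv' heq
    rcases hf v hv with ⟨h1, h2⟩ | ⟨t, ht, i, hi, h1, h2⟩ <;>
    rcases hf v' hv' with ⟨h1', h2'⟩ | ⟨t', ht', i', hi', h1', h2'⟩
    · exact h1.symm.trans (heq.trans h1')
    · refine absurd ?_ (h2 t' ht')
      rw [← h1, heq, h1']
      exact List.getElem_mem _
    · refine absurd ?_ (h2' t ht)
      rw [← h1', ← heq, h1]
      exact List.getElem_mem _
    · have htt : t = t' := by
        by_contra hne
        refine hd t ht t' ht' hne (a := f v) ?_ ?_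
        · rw [h1]; exact List.getElem_mem _
        · rw [heq, h1']; exact List.getElem_mem _
      subst htt
      obtain ⟨s, hs, hP⟩ := hp t ht
      have hii : i = i' := by
        refine (hP.nodup.getElem_inj_iff (hi := by omega) (hj := by omega)).1 ?_
        rw [← h1, ← h1', heq]
      subst hii
      rw [h2, h2']
  · intro v hv hfT
    obtain ⟨s, hs, hP⟩ := hp _ hfT
    have hl := hP.last
    have hmem : f v ∈ p (f v) := List.mem_of_getLast? hl
    rcases hf v hv with ⟨h1, h2⟩ | ⟨t, ht, i, hi, h1, h2⟩
    · rw [h1] at hfT hmem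
      exact h2 _ hfT hmem
    · have htt : t = f v := by
        by_contra hne
        have hm : (p t)[i] ∈ p t := List.getElem_mem _
        exact hd t ht _ hfT hne (h1 ▸ hm) hmem
      have hPt : IsDirPath D (p t) s (f v) := by
        have hpp : p t = p (f v) := congrArg p htt
        rw [hpp]
        exact hP
      have hl' := hPt.last
      rw [List.getLast?_eq_getElem?, List.getElem?_eq_getElem (by omega)] at hl'
      simp only [Option.some.injEq] at hl'
      rw [h1] at hl'
      have := (hPt.nodup.getElem_inj_iff (hi := by omega) (hj := by omega)).1 hl'
      omega
  · intro v hv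
    rcases hf v hv with ⟨h1, h2⟩ | ⟨t, ht, i, hi, h1, h2⟩
    · exact Or.inl h1
    · right
      obtain ⟨s, hs, hP⟩ := hp t ht
      have := List.isChain_iff_getElem.1 hP.chain i hi
      rw [h1]
      conv_rhs => rw [h2]
      exact this

theorem iterate_cancel {S : Set W} {f : W → W} (hinj : Set.InjOn f Sᶜ) :
    ∀ (i j : ℕ) (t t' : W), i ≤ j → (∀ m < i, f^[m] t ∈ Sᶜ) → (∀ m < j, f^[m] t' ∈ Sᶜ) →
      f^[i] t = f^[j] t' → t = f^[j - i] t' := by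
  intro i
  induction i with
  | zero => intro j t t' _ _ _ h; simpa using h
  | succ i ih =>
    intro j t t' hij h1 h2 h
    obtain ⟨j, rfl⟩ : ∃ j', j = j' + 1 := ⟨j - 1, by omega⟩
    rw [Function.iterate_succ_apply', Function.iterate_succ_apply'] at h
    have := ih j t t' (by omega) (fun m hm => h1 m (by omega)) (fun m hm => h2 m (by omega))
      (hinj (h1 i (by omega)) (h2 j (by omega)) h)
    rwa [Nat.add_sub_add_right]

theorem isLinked_of_matching [Finite W] {D : Digraph W} {S T : Set W} {f : W → W}
    (hinj : Set.InjOn f Sᶜ) (hT : ∀ v ∈ Sᶜ, f v ∉ T)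
    (hadj : ∀ v ∈ Sᶜ, f v = v ∨ D.Adj (f v) v) : IsLinked D S T := by
  classical
  have hcan : ∀ (i j : ℕ) (t t' : W), t ∈ T → i ≤ j → (∀ m < j, f^[m] t' ∈ Sᶜ) →
      (∀ m < i, f^[m] t ∈ Sᶜ) → f^[i] t = f^[j] t' → i = j := by
    intro i j t t' ht hij h2 h1 h
    have hc := iterate_cancel hinj i j t t' hij h1 h2 h
    by_contra hne
    obtain ⟨d, hd⟩ : ∃ d, j - i = d + 1 := ⟨j - i - 1, by omega⟩
    rw [hd, Function.iterate_succ_apply'] at hc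
    exact hT _ (h2 d (by omega)) (hc ▸ ht)
  have hex : ∀ t ∈ T, ∃ n, f^[n] t ∈ S := by
    intro t ht
    by_contra hno
    push Not at hno
    obtain ⟨i, j, hij, h⟩ := Finite.exists_ne_map_eq_of_infinite (fun n : ℕ => f^[n] t)
    rcases le_total i j with hle | hle
    · exact hij (hcan i j t t ht hle (fun m _ => hno m) (fun m _ => hno m) h)
    · exact hij (hcan j i t t ht hle (fun m _ => hno m) (fun m _ => hno m) h.symm).symm
  let n : W → ℕ := fun t => if h : ∃ n, f^[n] t ∈ S then Nat.find h else 0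
  have hn : ∀ t ∈ T, f^[n t] t ∈ S ∧ ∀ m < n t, f^[m] t ∈ Sᶜ := by
    intro t ht
    have h := hex t ht
    simp only [n, dif_pos h]
    exact ⟨Nat.find_spec h, fun m hm => Nat.find_min h hm⟩
  refine ⟨fun t => (List.range (n t + 1)).map fun i => f^[n t - i] t, ?_, ?_⟩
  · intro t ht
    obtain ⟨hS, hlt⟩ := hn t ht
    have hi : ∀ i j, i ≤ n t → j ≤ n t → f^[i] t = f^[j] t → i = j := by
      intro i j hi hj h
      rcases le_total i j with hle | hle
      · exact hcan i j t t ht hle (fun m hm => hlt m (by omega)) (fun m hm => hlt m (by omega)) h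
      · exact (hcan j i t t ht hle (fun m hm => hlt m (by omega))
          (fun m hm => hlt m (by omega)) h.symm).symm
    refine ⟨_, hS, ?_, ?_, ?_, ?_⟩
    · rw [List.isChain_iff_getElem]
      intro i hil
      simp only [List.length_map, List.length_range] at hil
      simp only [List.getElem_map, List.getElem_range]
      obtain ⟨d, hd⟩ : ∃ d, n t - i = d + 1 := ⟨n t - i - 1, by omega⟩
      have hd' : n t - (i + 1) = d := by omega
      rw [hd, hd']
      rcases hadj _ (hlt d (by omega)) with h | h
      · rw [← Function.iterate_succ_apply' f] at h
        have := hi (d + 1) d (by omega) (by omega) h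
        omega
      · rwa [Function.iterate_succ_apply']
    · refine List.Nodup.map_on ?_ List.nodup_range
      intro i hil j hjl h
      simp only [List.mem_range] at hil hjl
      have := hi _ _ (by omega) (by omega) h
      omega
    · simp [List.head?_eq_getElem?]
    · simp [List.getLast?_eq_getElem?]
  · intro t ht t' ht' hne a ha ha'
    simp only [List.mem_map, List.mem_range] at ha ha'
    obtain ⟨i, hi, rfl⟩ := ha
    obtain ⟨j, hj, h⟩ := ha'
    obtain ⟨-, hlt⟩ := hn t ht
    obtain ⟨-, hlt'⟩ := hn t' ht'
    apply hne
    have key : n t - i = n t' - j := by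
      rcases le_total (n t - i) (n t' - j) with hle | hle
      · exact hcan _ _ t t' ht hle (fun m hm => hlt' m (by omega))
          (fun m hm => hlt m (by omega)) h.symm
      · exact (hcan _ _ t' t ht' hle (fun m hm => hlt m (by omega))
          (fun m hm => hlt' m (by omega)) h).symm
    have := iterate_cancel hinj (n t - i) (n t' - j) t t' key.le
      (fun m hm => hlt m (by omega)) (fun m hm => hlt' m (by omega)) h.symm
    simpa [key] using this

theorem matching_augment [Finite W] {L A : Set W} {f : W → W} (hf : Set.InjOn f L)
    (hfA : ∀ v ∈ L, f v ∉ A) :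
    ∀ (N : ℕ) (B : Set W) (g : W → W), {v ∈ L | f v ≠ g v}.ncard = N → Set.InjOn g L →
      (∀ v ∈ L, g v ∉ B) → A.ncard < B.ncard →
      ∃ b ∈ B, b ∉ A ∧ ∃ h : W → W, Set.InjOn h L ∧ (∀ v ∈ L, h v ∉ insert b A) ∧
        ∀ v ∈ L, h v = f v ∨ h v = g v := by
  classical
  intro N
  induction N using Nat.strong_induction_on with
  | _ N ih =>
  intro B g hN hg hgB hAB
  obtain ⟨b, hbB, hbA⟩ := Set.exists_mem_notMem_of_ncard_lt_ncard hAB (Set.toFinite _)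
  by_cases hb : ∃ l ∈ L, f l = b
  swap
  · push Not at hb
    refine ⟨b, hbB, hbA, f, hf, fun v hv => ?_, fun v _ => Or.inl rfl⟩
    rw [Set.mem_insert_iff, not_or]
    exact ⟨hb v hv, hfA v hv⟩
  obtain ⟨l, hl, rfl⟩ := hb
  have hne : f l ≠ g l := fun h => hgB l hl (h ▸ hbB)
  let g' : W → W := Function.update g l (f l)
  have hg'l : g' l = f l := by simp [g']
  have hg'v : ∀ v, v ≠ l → g' v = g v := fun v hv => by simp [g', hv]
  have hfg : ∀ v ∈ L, g v ≠ f l := fun v hv h => hgB v hv (h ▸ hbB)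
  have hg'inj : Set.InjOn g' L := by
    intro v hv w hw h
    by_cases h1 : v = l <;> by_cases h2 : w = l
    · rw [h1, h2]
    · subst h1; rw [hg'l, hg'v w h2] at h; exact absurd h.symm (hfg w hw)
    · subst h2; rw [hg'l, hg'v v h1] at h; exact absurd h (hfg v hv)
    · rw [hg'v v h1, hg'v w h2] at h; exact hg hv hw h
  let B' : Set W := insert (g l) (B \ {f l})
  have hg'B : ∀ v ∈ L, g' v ∉ B' := by
    intro v hv h
    by_cases h1 : v = l
    · subst h1
      rw [hg'l] at h
      simp [B', hne] at h
    · rw [hg'v v h1] at h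
      rcases h with h | h
      · exact h1 (hg hv hl h)
      · exact hgB v hv h.1
  have hcard : B'.ncard = B.ncard := by
    rw [Set.ncard_insert_of_notMem (fun h => hgB l hl h.1) (Set.toFinite _)]
    exact Set.ncard_sdiff_singleton_add_one hbB (Set.toFinite _)
  have hlt : {v ∈ L | f v ≠ g' v}.ncard < N := by
    rw [← hN]
    refine Set.ncard_lt_ncard ⟨?_, fun h => ?_⟩ (Set.toFinite _)
    · rintro v ⟨hv, hvne⟩
      have : v ≠ l := by rintro rfl; exact hvne hg'l.symm
      exact ⟨hv, by rwa [hg'v v this] at hvne⟩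
    · exact (h (show l ∈ {v ∈ L | f v ≠ g v} from ⟨hl, hne⟩)).2 hg'l.symm
  obtain ⟨b, hbB', hbA', h, hinj, hav, hmix⟩ :=
    ih _ hlt B' g' rfl hg'inj hg'B (by rw [hcard]; exact hAB)
  have hhl : h l = f l := by
    rcases hmix l hl with h1 | h1
    · exact h1
    · rw [h1, hg'l]
  rcases hbB' with rfl | hbB'
  · refine ⟨f l, hbB, hbA, Function.update h l (g l), ?_, ?_, ?_⟩
    · intro v hv w hw heq
      have hnot : ∀ v ∈ L, h v ≠ g l := fun v hv h' => hav v hv (h' ▸ Set.mem_insert _ _)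
      by_cases h1 : v = l <;> by_cases h2 : w = l
      · rw [h1, h2]
      · subst h1; simp [h2] at heq; exact absurd heq.symm (hnot w hw)
      · subst h2; simp [h1] at heq; exact absurd heq (hnot v hv)
      · simp [h1, h2] at heq; exact hinj hv hw heq
    · intro v hv
      rw [Set.mem_insert_iff, not_or]
      by_cases h1 : v = l
      · subst h1
        simp only [Function.update_self]
        exact ⟨hne.symm, hbA'⟩
      · simp only [Function.update_of_ne h1]
        exact ⟨fun h' => h1 (hinj hv hl (h'.trans hhl.symm)),
          fun h' => hav v hv (Set.mem_insert_of_mem _ h')⟩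
    · intro v hv
      by_cases h1 : v = l
      · subst h1; simp
      · simp only [Function.update_of_ne h1]
        simpa [hg'v v h1] using hmix v hv
  · refine ⟨b, hbB'.1, hbA', h, hinj, hav, fun v hv => ?_⟩
    by_cases h1 : v = l
    · subst h1; exact Or.inl hhl
    · simpa [hg'v v h1] using hmix v hv

theorem IsLinked.augment [Finite W] {D : Digraph W} {S A B : Set W} (hA : IsLinked D S A)
    (hB : IsLinked D S B) (hAB : A.ncard < B.ncard) :
    ∃ b ∈ B, b ∉ A ∧ IsLinked D S (insert b A) := by
  obtain ⟨f, hf, hfA, hfadj⟩ := hA.exists_matching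
  obtain ⟨g, hg, hgB, hgadj⟩ := hB.exists_matching
  obtain ⟨b, hbB, hbA, h, hh, hhA, hmix⟩ := matching_augment hf hfA _ B g rfl hg hgB hAB
  refine ⟨b, hbB, hbA, isLinked_of_matching hh hhA fun v hv => ?_⟩
  rcases hmix v hv with h1 | h1 <;> rw [h1]
  · exact hfadj v hv
  · exact hgadj v hv

/-- The gammoid on `D` with sources `S` and ground set `U`: a set is independent if it is contained
in `U` and linked to `S`. -/
def gammoid [Finite W] (D : Digraph W) (S U : Set W) : Matroid W :=
  (IndepMatroid.ofFinite (E := U) (Set.toFinite U) (fun I => I ⊆ U ∧ IsLinked D S I)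
    ⟨Set.empty_subset U, isLinked_empty D S⟩
    (fun _ _ hJ hIJ => ⟨hIJ.trans hJ.1, hJ.2.subset hIJ⟩)
    (fun _ _ hI hJ hc => by
      obtain ⟨b, hb, hbI, hl⟩ := hI.2.augment hJ.2 hc
      exact ⟨b, hb, hbI, Set.insert_subset (hJ.1 hb) hI.1, hl⟩)
    (fun _ hI => hI.1)).matroid

@[simp] theorem gammoid_indep [Finite W] (D : Digraph W) (S U I : Set W) :
    (gammoid D S U).Indep I ↔ I ⊆ U ∧ IsLinked D S I := Iff.rfl

@[simp] theorem gammoid_ground [Finite W] (D : Digraph W) (S U : Set W) :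
    (gammoid D S U).E = U := rfl

end Gammoid

/-! ### Extension and representative sets -/

section Representative

variable {W : Type*}

/-- `A` extends `B` in `M`; independence of `A ∪ B` entails that of `A` and of `B`. -/
def Extends (M : Matroid W) (A B : Set W) : Prop := Disjoint A B ∧ M.Indep (A ∪ B)

/-- `A` is a member of `𝒜` that extends `I`, and no other member of `𝒜` extends `I`. -/
def UniquelyExtends (M : Matroid W) (𝒜 : Set (Set W)) (A I : Set W) : Prop :=
  A ∈ 𝒜 ∧ Extends M A I ∧ ∀ A' ∈ 𝒜, Extends M A' I → A' = A

/-- `𝒜'` is a `q`-representative subfamily of `𝒜`. Members of `𝒜` need not be independent; the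
dependent ones extend nothing. -/
def IsRepresentative (M : Matroid W) (q : ℕ) (𝒜 𝒜' : Set (Set W)) : Prop :=
  𝒜' ⊆ 𝒜 ∧ ∀ B, M.Indep B → B.ncard ≤ q →
    ((∃ A ∈ 𝒜, Extends M A B) ↔ ∃ A ∈ 𝒜', Extends M A B)

end Representative

/-! ### Edge Subset Feedback Vertex Set -/

section FVS

variable {α β : Type*}

/-- The set `V(S)` of the endpoints of the edges in `S`. -/
def terminals (G : Graph α β) (S : Set β) : Set α := {v | ∃ e ∈ S, G.Inc e v}

/-- `v 0, e 0, v 1, e 1, …, v n, e n` is a cycle of length `n + 1` in the multigraph `G`, with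
`e i` joining `v i` to `v (i + 1)`, indices modulo `n + 1`. A loop is a cycle of length one, and
two parallel edges form a cycle of length two. -/
structure IsCycle (G : Graph α β) {n : ℕ} (v : Fin (n + 1) → α) (e : Fin (n + 1) → β) : Prop where
  vertex_injective : Function.Injective v
  edge_injective : Function.Injective e
  isLink : ∀ i, G.IsLink (e i) (v i) (v (i + 1))

/-- `X` is a solution for `(G, S, k)`: at most `k` vertices that meet every cycle of `G` containing
an edge of `S`. -/
structure IsSolution (G : Graph α β) (S : Set β) (k : ℕ) (X : Set α) : Prop where
  subset : X ⊆ V(G)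
  finite : X.Finite
  card_le : X.ncard ≤ k
  hits : ∀ (n : ℕ) (v : Fin (n + 1) → α) (e : Fin (n + 1) → β),
    IsCycle G v e → (∃ i, e i ∈ S) → ∃ i, v i ∈ X

/-- A dominant solution: one of minimum size that, among those of minimum size, contains the
maximum number of terminals. -/
structure IsDominantSolution (G : Graph α β) (S : Set β) (k : ℕ) (X : Set α) : Prop where
  isSolution : IsSolution G S k X
  min_card : ∀ Y, IsSolution G S k Y → X.ncard ≤ Y.ncard
  max_terminals : ∀ Y, IsSolution G S k Y → Y.ncard = X.ncard →
    (Y ∩ terminals G S).ncard ≤ (X ∩ terminals G S).ncard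

/-- Vertices `v`, `v'`, `v''` of `G₁`: `Copies.orig v`, `Copies.copy₁ v`, `Copies.copy₂ v`. -/
inductive Copies (α : Type*) : Type _
  | orig (v : α)
  | copy₁ (v : α)
  | copy₂ (v : α)

instance [Finite α] : Finite (Copies α) :=
  Finite.of_surjective (α := α ⊕ α ⊕ α)
    (fun x => x.elim .orig (fun y => y.elim .copy₁ .copy₂)) (by
      rintro (v | v | v)
      · exact ⟨.inl v, rfl⟩
      · exact ⟨.inr (.inl v), rfl⟩
      · exact ⟨.inr (.inr v), rfl⟩)

/-- The graph `G₁`: the undirected graph `G - S` together with, for each vertex `v`, two sink-only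
copies of `v` with an arc from `u` to each copy whenever `{u, v}` is an edge of `G - S`. -/
def digraph₁ (G : Graph α β) (S : Set β) : Digraph (Copies α) where
  Adj a b := match a, b with
    | .orig u, .orig v => (G.deleteEdges S).Adj u v
    | .orig u, .copy₁ v => (G.deleteEdges S).Adj u v
    | .orig u, .copy₂ v => (G.deleteEdges S).Adj u v
    | _, _ => False

/-- The gammoid on `G₁` with sources `T = V(S)` and ground set `V₁ = {v, v', v'' | v ∈ V}`. -/
def matroid₁ [Finite α] (G : Graph α β) (S : Set β) : Matroid (Copies α) :=
  gammoid (digraph₁ G S) (.orig '' terminals G S)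
    (.orig '' V(G) ∪ .copy₁ '' V(G) ∪ .copy₂ '' V(G))

/-- The graph `G₂ = K_{k,n}`, all of whose edges are directed from the `k` vertices of one side to
the copies `v̂ = Sum.inr v` of the vertices of `G`. -/
def digraph₂ (G : Graph α β) (k : ℕ) : Digraph (Fin k ⊕ α) where
  Adj a b := match a, b with
    | .inl _, .inr v => v ∈ V(G)
    | _, _ => False

/-- The gammoid on `G₂` with the `k` vertices of the first side as sources and with ground set
`{v̂ | v ∈ V}`. -/
def matroid₂ [Finite α] (G : Graph α β) (k : ℕ) : Matroid (Fin k ⊕ α) :=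
  gammoid (digraph₂ G k) (Set.range .inl) (.inr '' V(G))

/-- The direct sum `M = M₁ ⊕ M₂`. -/
def directSumMatroid [Finite α] (G : Graph α β) (S : Set β) (k : ℕ) :
    Matroid (Copies α ⊕ (Fin k ⊕ α)) :=
  (matroid₁ G S).sum (matroid₂ G k)

/-- The triple `{v', v'', v̂}`. -/
def triple (k : ℕ) (v : α) : Set (Copies α ⊕ (Fin k ⊕ α)) :=
  {.inl (.copy₁ v), .inl (.copy₂ v), .inr (.inr v)}

/-- The family of the triples `{v', v'', v̂}` with `v ∈ V`. -/
def triples (G : Graph α β) (k : ℕ) : Set (Set (Copies α ⊕ (Fin k ⊕ α))) :=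
  triple k '' V(G)

end FVS

end SubsetFVS

namespace SubsetFVS

/-! ### Acyclic edge sets over a quotient, and the cost of identifying vertices. -/

section AcyclicEdges

variable {α β : Type*}

/-! Contract the components of `G - S - X`. Since `X` is a solution, the edges of `S` that avoid `X`
form a forest on the quotient (`IsSolution.edgeAcyclic`).

The core is an exchange argument (`IsDominantSolution.ncard_add_two_le`). Let `Y` be a nonempty set
of non-terminals of `X`. Putting `Y` back at worst fuses all terminal-containing components adjacent
to `Y` into one. If there were at most `|Y| + 1` of them, this would take at most `|Y|`
identifications, each spoiling at most one forest edge (`EdgeAcyclic.exists_merge`). Deleting one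
endpoint of each spoiled edge would give a solution no larger than `X` with strictly more terminals,
against dominance. So `Y` is adjacent to at least `|Y| + 2` such components.

By Hall's theorem, the vertices of `X \ T` together with `x'` and `x''` get pairwise distinct
components, hence disjoint paths starting at a set `R` of `|X \ T| + 2` terminals, one per
component. Trivial paths link the other terminals. Thus `X ∪ (T \ R)` with `x'`, `x''` is linked to
`T` (`IsDominantSolution.exists_isLinked`). The set `I` consists of `X ∪ (T \ R)` in the first
summand and of the hats of `X \ {x}` in the second.

No other triple extends `I`. For `v` in `X \ {x}`, the hat of `v` is already in `I`. For `v` outside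
`X`, the paths to `v'` and `v''` would have to start at different elements of `R` in the component
of `v`, which has at most one (`not_isLinked`). -/

theorem eqvGen_or_pair {P : α → α → Prop} {a b u v : α}
    (h : Relation.EqvGen (fun u v => P u v ∨ (u = a ∧ v = b)) u v) :
    Relation.EqvGen P u v ∨ (Relation.EqvGen P u a ∧ Relation.EqvGen P b v) ∨
      (Relation.EqvGen P u b ∧ Relation.EqvGen P a v) := by
  induction h with
  | rel u v h =>
    rcases h with h | ⟨rfl, rfl⟩
    · exact Or.inl (.rel _ _ h)
    · exact Or.inr (Or.inl ⟨.refl _, .refl _⟩)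
  | refl u => exact Or.inl (.refl _)
  | symm u v _ ih =>
    rcases ih with h | ⟨h, h'⟩ | ⟨h, h'⟩
    · exact Or.inl h.symm
    · exact Or.inr (Or.inr ⟨h'.symm, h.symm⟩)
    · exact Or.inr (Or.inl ⟨h'.symm, h.symm⟩)
  | trans u v w _ _ ih₁ ih₂ =>
    rcases ih₁ with h₁ | ⟨h₁, h₁'⟩ | ⟨h₁, h₁'⟩ <;>
    rcases ih₂ with h₂ | ⟨h₂, h₂'⟩ | ⟨h₂, h₂'⟩
    · exact Or.inl (h₁.trans _ _ _ h₂)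
    · exact Or.inr (Or.inl ⟨h₁.trans _ _ _ h₂, h₂'⟩)
    · exact Or.inr (Or.inr ⟨h₁.trans _ _ _ h₂, h₂'⟩)
    · exact Or.inr (Or.inl ⟨h₁, h₁'.trans _ _ _ h₂⟩)
    · exact Or.inr (Or.inl ⟨h₁, h₂'⟩)
    · exact Or.inl (h₁.trans _ _ _ h₂')
    · exact Or.inr (Or.inr ⟨h₁, h₁'.trans _ _ _ h₂⟩)
    · exact Or.inl (h₁.trans _ _ _ h₂')
    · exact Or.inr (Or.inr ⟨h₁, h₂'⟩)

/-- The equivalence relation generated by `R` and by the pairs `(s e, t e)` with `e ∈ F`. -/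
def EdgeConn (s t : β → α) (R : α → α → Prop) (F : Set β) : α → α → Prop :=
  Relation.EqvGen fun a b => R a b ∨ ∃ e ∈ F, a = s e ∧ b = t e

/-- Each edge of `F` is a bridge of the graph with edges `F` on the quotient by `R`. -/
def EdgeAcyclic (s t : β → α) (R : α → α → Prop) (F : Set β) : Prop :=
  ∀ e ∈ F, ¬ EdgeConn s t R (F \ {e}) (s e) (t e)

variable {s t : β → α} {R R' : α → α → Prop} {F F' : Set β}

theorem EdgeConn.mono (hR : ∀ a b, R a b → R' a b) (hF : F ⊆ F') {u v : α}
    (h : EdgeConn s t R F u v) : EdgeConn s t R' F' u v := by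
  refine Relation.EqvGen.mono ?_ _ _ h
  rintro a b (h | ⟨e, he, h⟩)
  · exact Or.inl (hR _ _ h)
  · exact Or.inr ⟨e, hF he, h⟩

theorem EdgeConn.symm {u v : α} (h : EdgeConn s t R F u v) : EdgeConn s t R F v u :=
  Relation.EqvGen.symm _ _ h

theorem EdgeConn.trans {u v w : α} (h : EdgeConn s t R F u v) (h' : EdgeConn s t R F v w) :
    EdgeConn s t R F u w :=
  Relation.EqvGen.trans _ _ _ h h'

theorem EdgeConn.of_rel {u v : α} (h : R u v) : EdgeConn s t R F u v :=
  Relation.EqvGen.rel _ _ (Or.inl h)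

theorem EdgeConn.of_mem {e : β} (h : e ∈ F) : EdgeConn s t R F (s e) (t e) :=
  Relation.EqvGen.rel _ _ (Or.inr ⟨e, h, rfl, rfl⟩)

theorem EdgeConn.remove_edge (f : β) {u v : α} (h : EdgeConn s t R F u v) :
    EdgeConn s t R (F \ {f}) u v ∨
      (EdgeConn s t R (F \ {f}) u (s f) ∧ EdgeConn s t R (F \ {f}) (t f) v) ∨
      (EdgeConn s t R (F \ {f}) u (t f) ∧ EdgeConn s t R (F \ {f}) (s f) v) := by
  refine eqvGen_or_pair (Relation.EqvGen.mono ?_ _ _ h)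
  rintro a b (h | ⟨e, he, h⟩)
  · exact Or.inl (Or.inl h)
  · by_cases hef : e = f
    · subst hef; exact Or.inr h
    · exact Or.inl (Or.inr ⟨e, ⟨he, hef⟩, h⟩)

theorem EdgeConn.remove_pair {a b : α} {u v : α}
    (h : EdgeConn s t (fun u v => R u v ∨ (u = a ∧ v = b)) F u v) :
    EdgeConn s t R F u v ∨
      (EdgeConn s t R F u a ∧ EdgeConn s t R F b v) ∨
      (EdgeConn s t R F u b ∧ EdgeConn s t R F a v) := by
  refine eqvGen_or_pair (Relation.EqvGen.mono ?_ _ _ h)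
  rintro a b ((h | h) | h)
  · exact Or.inl (Or.inl h)
  · exact Or.inr h
  · exact Or.inl (Or.inr h)

theorem EdgeAcyclic.subset (h : EdgeAcyclic s t R F) (hF : F' ⊆ F) : EdgeAcyclic s t R F' :=
  fun e he hc => h e (hF he) (hc.mono (fun _ _ h => h) (Set.sdiff_subset_sdiff_left hF))

/-- Two vertices that are not equivalent are separated by removing at most one edge of an acyclic
edge set. -/
theorem EdgeAcyclic.exists_separating (hfin : F.Finite) (h : EdgeAcyclic s t R F) {a b : α}
    (hab : ¬ EdgeConn s t R ∅ a b) :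
    ¬ EdgeConn s t R F a b ∨ ∃ g ∈ F, ¬ EdgeConn s t R (F \ {g}) a b := by
  induction F, hfin using Set.Finite.induction_on with
  | empty => exact Or.inl hab
  | @insert f F₀ hf _ ih =>
    have hF : insert f F₀ \ {f} = F₀ := Set.insert_sdiff_self_of_notMem hf
    by_cases hc : EdgeConn s t R F₀ a b
    swap
    · exact Or.inr ⟨f, Set.mem_insert _ _, by rwa [hF]⟩
    obtain h' | ⟨g, hg, hg'⟩ := ih (h.subset (Set.subset_insert _ _))
    · exact absurd hc h'
    -- The `g` that separates `a` from `b` in `F₀` still works with `f` added: a connection through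
    -- `f`, joined with the one in `F₀`, would connect the ends of `f` without `f`.
    · refine Or.inr ⟨g, Set.mem_insert_of_mem _ hg, fun hcon => ?_⟩
      have hsub : (insert f F₀ \ {g}) \ {f} ⊆ F₀ \ {g} := by
        rintro e ⟨⟨rfl | he, he'⟩, he''⟩
        · exact absurd rfl he''
        · exact ⟨he, he'⟩
      have hbr := h f (Set.mem_insert _ _)
      rw [hF] at hbr
      have up : ∀ {u v}, EdgeConn s t R ((insert f F₀ \ {g}) \ {f}) u v → EdgeConn s t R F₀ u v :=
        fun hh => hh.mono (fun _ _ h => h) (hsub.trans Set.sdiff_subset)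
      rcases hcon.remove_edge f with h1 | ⟨h1, h2⟩ | ⟨h1, h2⟩
      · exact hg' (h1.mono (fun _ _ h => h) hsub)
      · exact hbr (((up h1).symm.trans hc).trans (up h2).symm)
      · exact hbr (((up h2).trans hc.symm).trans (up h1))

/-- A new cycle would have to pass through the identification of `a` and `b`. That changes nothing
if they are already equivalent under `R`, and only glues two components if `F` does not connect
them. -/
theorem EdgeAcyclic.add_pair (h : EdgeAcyclic s t R F) {a b : α}
    (hab : EdgeConn s t R ∅ a b ∨ ¬ EdgeConn s t R F a b) :
    EdgeAcyclic s t (fun u v => R u v ∨ (u = a ∧ v = b)) F := by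
  intro e he hc
  have up : ∀ {u v}, EdgeConn s t R (F \ {e}) u v → EdgeConn s t R F u v :=
    fun hh => hh.mono (fun _ _ h => h) Set.sdiff_subset
  have hst : EdgeConn s t R F (s e) (t e) := .of_mem he
  rcases hab with hab | hab
  · replace hab : EdgeConn s t R (F \ {e}) a b :=
      hab.mono (fun _ _ h => h) (Set.empty_subset _)
    rcases hc.remove_pair with h1 | ⟨h1, h2⟩ | ⟨h1, h2⟩
    · exact h e he h1
    · exact h e he ((h1.trans hab).trans h2)
    · exact h e he ((h1.trans hab.symm).trans h2)
  · rcases hc.remove_pair with h1 | ⟨h1, h2⟩ | ⟨h1, h2⟩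
    · exact h e he h1
    · exact hab (((up h1).symm.trans hst).trans (up h2).symm)
    · exact hab (((up h2).trans hst.symm).trans (up h1))

/-- Identifying two vertices costs at most one edge of an acyclic edge set. -/
theorem EdgeAcyclic.exists_add_pair (hfin : F.Finite) (h : EdgeAcyclic s t R F) (a b : α) :
    ∃ F' ⊆ F, (F \ F').ncard ≤ 1 ∧ EdgeAcyclic s t (fun u v => R u v ∨ (u = a ∧ v = b)) F' := by
  by_cases hab : EdgeConn s t R ∅ a b
  · exact ⟨F, subset_rfl, by simp, h.add_pair (Or.inl hab)⟩
  obtain h' | ⟨g, hg, hg'⟩ := h.exists_separating hfin hab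
  · exact ⟨F, subset_rfl, by simp, h.add_pair (Or.inr h')⟩
  · refine ⟨F \ {g}, Set.sdiff_subset, ?_, (h.subset Set.sdiff_subset).add_pair (Or.inr hg')⟩
    refine (Set.ncard_le_ncard (t := {g}) ?_ (Set.finite_singleton g)).trans (by simp)
    rintro e ⟨he, he'⟩
    by_contra hne
    exact he' ⟨he, hne⟩

/-- Identifying all vertices of `C` with `a` costs at most `|C|` edges of an acyclic edge set. -/
theorem EdgeAcyclic.exists_merge (hfin : F.Finite) (h : EdgeAcyclic s t R F) (a : α) (C : Set α)
    (hC : C.Finite) :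
    ∃ F' ⊆ F, (F \ F').ncard ≤ C.ncard ∧
      EdgeAcyclic s t (fun u v => R u v ∨ (u = a ∧ v ∈ C)) F' := by
  induction C, hC using Set.Finite.induction_on with
  | empty => exact ⟨F, subset_rfl, by simp, by simpa using h⟩
  | @insert b C₀ hb hC₀ ih =>
    obtain ⟨F₁, hF₁, hcard₁, hac₁⟩ := ih
    obtain ⟨F₂, hF₂, hcard₂, hac₂⟩ := hac₁.exists_add_pair (hfin.subset hF₁) a b
    refine ⟨F₂, hF₂.trans hF₁, ?_, ?_⟩
    · rw [Set.ncard_insert_of_notMem hb hC₀]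
      have hsub : F \ F₂ ⊆ (F \ F₁) ∪ (F₁ \ F₂) := by
        rintro e ⟨he, he'⟩
        by_cases h1 : e ∈ F₁
        · exact Or.inr ⟨h1, he'⟩
        · exact Or.inl ⟨he, h1⟩
      have := (Set.ncard_le_ncard hsub ((hfin.sdiff).union (hfin.subset hF₁).sdiff)).trans
        (Set.ncard_union_le _ _)
      omega
    · refine fun e he hc => hac₂ e he (hc.mono ?_ subset_rfl)
      rintro u v (h' | ⟨h1, h2 | h2⟩)
      · exact Or.inl (Or.inl h')
      · exact Or.inr ⟨h1, h2⟩
      · exact Or.inl (Or.inr ⟨h1, h2⟩)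

end AcyclicEdges
end SubsetFVS
namespace SubsetFVS

/-! ### Solutions in terms of reachability outside `X`. -/

section Reachability

variable {α β : Type*}

/-- The simple graph of the pairs of vertices outside `X` joined by an edge of `G` in `F`. -/
def restrictedGraph (G : Graph α β) (X : Set α) (F : Set β) : SimpleGraph α where
  Adj a b := a ≠ b ∧ a ∉ X ∧ b ∉ X ∧ ∃ e ∈ F, G.IsLink e a b
  symm := ⟨fun _ _ ⟨hne, ha, hb, e, he, hl⟩ => ⟨hne.symm, hb, ha, e, he, hl.symm⟩⟩
  loopless := ⟨fun _ h => h.1 rfl⟩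

variable {G : Graph α β} {S F : Set β} {X : Set α} {k : ℕ}

theorem reachable_of_isLink {a b : α} {e : β} (ha : a ∉ X) (hb : b ∉ X) (he : e ∈ F)
    (h : G.IsLink e a b) : (restrictedGraph G X F).Reachable a b := by
  by_cases hab : a = b
  · rw [hab]
  · exact SimpleGraph.Adj.reachable ⟨hab, ha, hb, e, he, h⟩

/-- A path from `u` to `v` that avoids `e` and `X` closes up with `e` to a cycle missed by `X`. A
loop `e` is the case of a path of length zero. -/
theorem IsSolution.not_reachable (hX : IsSolution G S k X) {e : β} (he : e ∈ S) {u v : α}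
    (h : G.IsLink e u v) (hu : u ∉ X) : ¬ (restrictedGraph G X {e}ᶜ).Reachable u v := by
  intro hr
  obtain ⟨p, hp⟩ := hr.exists_isPath
  have hadj : ∀ i : Fin p.length, ∃ f ∈ ({e}ᶜ : Set β),
      G.IsLink f (p.getVert i.castSucc) (p.getVert i.succ) := fun i =>
    (p.adj_getVert_succ i.2).2.2.2
  choose f hf hfl using hadj
  have hv : Function.Injective fun i : Fin (p.length + 1) => p.getVert i := fun i j hij =>
    Fin.ext (hp.getVert_injOn (by simpa using Nat.lt_succ_iff.1 i.2)
      (by simpa using Nat.lt_succ_iff.1 j.2) hij)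
  have hcyc : IsCycle G (fun i : Fin (p.length + 1) => p.getVert i)
      (Fin.snoc (α := fun _ => β) f e) := by
    refine ⟨hv, ?_, ?_⟩
    · intro i j
      induction i using Fin.lastCases with
      | last =>
        induction j using Fin.lastCases with
        | last => simp
        | cast j => simp only [Fin.snoc_last, Fin.snoc_castSucc]; exact fun h => absurd h.symm (hf j)
      | cast i =>
        induction j using Fin.lastCases with
        | last => simp only [Fin.snoc_last, Fin.snoc_castSucc]; exact fun h => absurd h (hf i)
        | cast j =>
          simp only [Fin.snoc_castSucc]
          intro hij
          have h1 := hfl i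
          rw [hij] at h1
          -- An edge used at two positions has the same ends there: in the same order the positions
          -- agree, and in opposite order `i = j + 1` and `j = i + 1`.
          rcases h1.eq_and_eq_or_eq_and_eq (hfl j) with ⟨h2, -⟩ | ⟨h2, h3⟩
          · exact hv h2
          · have h2 : i.castSucc = j.succ := hv h2
            have h3 : i.succ = j.castSucc := hv h3
            simp only [Fin.ext_iff, Fin.val_castSucc, Fin.val_succ] at h2 h3
            omega
    · intro i
      induction i using Fin.lastCases with
      | last => simpa using h.symm
      | cast i => simpa using hfl i
  obtain ⟨i, hi⟩ := hX.hits _ _ _ hcyc ⟨Fin.last _, by simpa using he⟩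
  induction i using Fin.cases with
  | zero => exact hu (by simpa using hi)
  | succ i => exact (p.adj_getVert_succ i.2).2.2.1 hi

-- Going round a cycle missed by `X`, from one end of its edge in `S` the long way to the other,
-- never uses that edge.
open Fin.NatCast Fin.CommRing in
theorem IsSolution.of_not_reachable (hsub : X ⊆ V(G)) (hfin : X.Finite) (hk : X.ncard ≤ k)
    (h : ∀ e ∈ S, ∀ u v, G.IsLink e u v → u ∉ X → v ∉ X →
      ¬ (restrictedGraph G X {e}ᶜ).Reachable u v) : IsSolution G S k X := by
  refine ⟨hsub, hfin, hk, fun n v e hc ⟨i, hi⟩ => ?_⟩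
  by_contra! hX
  have hreach : ∀ m : ℕ, m ≤ n →
      (restrictedGraph G X {e i}ᶜ).Reachable (v (i + 1)) (v (i + 1 + (m : Fin (n + 1)))) := by
    intro m
    induction m with
    | zero => intro _; simp
    | succ m ih =>
      intro hm
      refine (ih (by omega)).trans ?_
      refine reachable_of_isLink (e := e (i + 1 + m)) (hX _) (hX _) (fun heq => ?_) ?_
      -- Returning to edge `i` would force `n + 1 ∣ m + 1`, impossible for `m + 1 ≤ n`.
      · have h1 : ((m + 1 : ℕ) : Fin (n + 1)) = 0 := by
          have := hc.edge_injective heq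
          push_cast
          rw [add_assoc, add_eq_left] at this
          exact (add_comm _ _).trans this
        rw [Fin.natCast_eq_zero] at h1
        exact absurd (Nat.le_of_dvd (by omega) h1) (by omega)
      · push_cast
        rw [← add_assoc]
        exact hc.isLink (i + 1 + m)
  have hn := hreach n le_rfl
  have hin : i + 1 + (n : Fin (n + 1)) = i := by
    have h1 : ((n + 1 : ℕ) : Fin (n + 1)) = 0 := by simp
    push_cast at h1
    rw [add_assoc, add_comm (1 : Fin (n + 1)), h1, add_zero]
  rw [hin] at hn
  exact h _ hi _ _ (hc.isLink i) (hX _) (hX _) hn.symm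

end Reachability
end SubsetFVS
namespace SubsetFVS

/-! ### Exchanging non-terminals of a dominant solution for terminals. -/

section Exchange

variable {α β : Type*}

/-- The components of `G - S - X` that contain a terminal and have a neighbour in `Y` along an edge
outside `S`. -/
def adjacentComponents (G : Graph α β) (S : Set β) (X Y : Set α) :
    Set (restrictedGraph G X Sᶜ).ConnectedComponent :=
  {C | (∃ r ∈ terminals G S, r ∉ X ∧ (restrictedGraph G X Sᶜ).connectedComponentMk r = C) ∧
    ∃ y ∈ Y, ∃ a ∉ X, (restrictedGraph G X Sᶜ).connectedComponentMk a = C ∧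
      ∃ e ∉ S, G.IsLink e a y}

variable {G : Graph α β} {S : Set β} {X Y : Set α} {k : ℕ}

/-- Every generator of the connection without `e` is an edge of `G - X` other than `e`, so a
connection between the ends of `e` contradicts `IsSolution.not_reachable`. -/
theorem IsSolution.edgeAcyclic (hX : IsSolution G S k X) {s t : β → α}
    (hst : ∀ e ∈ S, G.IsLink e (s e) (t e)) :
    EdgeAcyclic s t (restrictedGraph G X Sᶜ).Adj {e ∈ S | s e ∉ X ∧ t e ∉ X} := by
  rintro e ⟨he, hs, ht⟩ hc
  refine hX.not_reachable he (hst e he) hs ?_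
  have : ∀ u v, EdgeConn s t (restrictedGraph G X Sᶜ).Adj ({e ∈ S | s e ∉ X ∧ t e ∉ X} \ {e}) u v →
      (restrictedGraph G X {e}ᶜ).Reachable u v := by
    intro u v h
    induction h with
    | rel u v h =>
      rcases h with ⟨-, hu, hv, f, hf, hl⟩ | ⟨f, ⟨⟨hf, hs, ht⟩, hfe⟩, rfl, rfl⟩
      · exact reachable_of_isLink hu hv (fun (h : f = e) => hf (h ▸ he)) hl
      · exact reachable_of_isLink hs ht hfe (hst f hf)
    | refl u => exact .refl _
    | symm u v _ ih => exact ih.symm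
    | trans u v w _ _ ih₁ ih₂ => exact ih₁.trans ih₂
  exact this _ _ hc

theorem EdgeConn.of_reachable {s t : β → α} {R : α → α → Prop} {F : Set β} {H : SimpleGraph α}
    (hR : ∀ a b, H.Adj a b → R a b) {u v : α} (h : H.Reachable u v) : EdgeConn s t R F u v := by
  obtain ⟨p⟩ := h
  induction p with
  | nil => exact Relation.EqvGen.refl _
  | cons h _ ih => exact (EdgeConn.of_rel (hR _ _ h)).trans ih

/-- If all terminals in components adjacent to `Y` are identified, then paths between terminals
that avoid `(X \ Y) ∪ Z` and `e` can be shortcut outside `X`. -/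
theorem edgeConn_of_reachable_exchange {s t : β → α}
    (hst : ∀ e ∈ S, G.IsLink e (s e) (t e)) (hY : Disjoint Y (terminals G S))
    {R : α → α → Prop} (hR : ∀ a b, (restrictedGraph G X Sᶜ).Adj a b → R a b)
    {F : Set β} {c : α}
    (hc : ∀ b, (restrictedGraph G X Sᶜ).connectedComponentMk b ∈ adjacentComponents G S X Y →
      EdgeConn s t R ∅ c b) {Z : Set α} {e : β}
    (hF : ∀ f ∈ S, f ≠ e → s f ∉ X → t f ∉ X → s f ∉ Z → t f ∉ Z → f ∈ F)
    {u v : α} (hu : u ∈ terminals G S) (hv : v ∈ terminals G S) (huX : u ∉ X) (hvX : v ∉ X)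
    (h : (restrictedGraph G (X \ Y ∪ Z) {e}ᶜ).Reachable u v) : EdgeConn s t R F u v := by
  set H := restrictedGraph G X Sᶜ with hH
  replace hc : ∀ b, H.connectedComponentMk b ∈ adjacentComponents G S X Y →
      EdgeConn s t R F c b := fun b hb => (hc b hb).mono (fun _ _ h => h) (Set.empty_subset _)
  -- Invariant along the walk: either `b` is connected to `u` and its component has a terminal, or
  -- `u` is connected to the merged point `c` and `b` lies in `Y` or in a component adjacent to `Y`.
  -- In the second case the component may lack terminals, so `b` itself need not be connected to
  -- `c`.
  let Inv : α → Prop := fun b =>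
    (b ∉ X ∧ EdgeConn s t R F u b ∧ ∃ r ∈ terminals G S, r ∉ X ∧ H.Reachable r b) ∨
    (EdgeConn s t R F u c ∧ (b ∈ Y ∨ b ∉ X ∧
      ∃ y ∈ Y, ∃ a ∉ X, H.Reachable a b ∧ ∃ f ∉ S, G.IsLink f a y))
  have hmem : ∀ b, (∃ r ∈ terminals G S, r ∉ X ∧ H.Reachable r b) →
      (∃ y ∈ Y, ∃ a ∉ X, H.Reachable a b ∧ ∃ f ∉ S, G.IsLink f a y) →
      EdgeConn s t R F c b := by
    rintro b ⟨r, hr, hrX, hrb⟩ ⟨y, hy, a, ha, hab, hf⟩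
    exact hc b ⟨⟨r, hr, hrX, SimpleGraph.ConnectedComponent.sound hrb⟩,
      ⟨y, hy, a, ha, SimpleGraph.ConnectedComponent.sound hab, hf⟩⟩
  have hterm : ∀ {f a b}, f ∈ S → G.IsLink f a b → a ∈ terminals G S := fun hf hl =>
    ⟨_, hf, hl.inc_left⟩
  have hYT : ∀ {a}, a ∈ Y → a ∈ terminals G S → False := fun h1 h2 =>
    Set.disjoint_left.1 hY h1 h2
  have step₁ : ∀ a b, EdgeConn s t R F u a → a ∉ X →
      (∃ r ∈ terminals G S, r ∉ X ∧ H.Reachable r a) →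
      (restrictedGraph G (X \ Y ∪ Z) {e}ᶜ).Adj a b → Inv b := by
    rintro a b hua haX hr ⟨-, ha, hb, f, hfe, hl⟩
    have haZ : a ∉ Z := fun h => ha (Or.inr h)
    have hbZ : b ∉ Z := fun h => hb (Or.inr h)
    by_cases hf : f ∈ S
    · have hbT := hterm hf hl.symm
      have hbX : b ∉ X := fun h => hb (Or.inl ⟨h, fun h' => hYT h' hbT⟩)
      refine Or.inl ⟨hbX, hua.trans ?_, b, hbT, hbX, .refl _⟩
      rcases hl.eq_and_eq_or_eq_and_eq (hst f hf) with ⟨rfl, rfl⟩ | ⟨rfl, rfl⟩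
      · exact .of_mem (hF f hf hfe haX hbX haZ hbZ)
      · exact (EdgeConn.of_mem (hF f hf hfe hbX haX hbZ haZ)).symm
    · by_cases hbX : b ∈ X
      · have hbY : b ∈ Y := by
          by_contra h
          exact hb (Or.inl ⟨hbX, h⟩)
        exact Or.inr ⟨hua.trans (hmem a hr ⟨b, hbY, a, haX, .refl _, f, hf, hl⟩).symm, Or.inl hbY⟩
      · have hab : H.Reachable a b := reachable_of_isLink haX hbX hf hl
        obtain ⟨r, hrT, hrX, hra⟩ := hr
        exact Or.inl ⟨hbX, hua.trans (.of_reachable hR hab), r, hrT, hrX, hra.trans hab⟩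
  have step : ∀ a b, Inv a → (restrictedGraph G (X \ Y ∪ Z) {e}ᶜ).Adj a b → Inv b := by
    rintro a b (⟨haX, hua, hr⟩ | ⟨huc, hD⟩) hadj
    · exact step₁ a b hua haX hr hadj
    have hadj' := hadj
    obtain ⟨-, ha, hb, f, hfe, hl⟩ := hadj'
    by_cases hbY : b ∈ Y
    · exact Or.inr ⟨huc, Or.inl hbY⟩
    have hbX : b ∉ X := fun h => hb (Or.inl ⟨h, hbY⟩)
    by_cases hf : f ∈ S
    · have haT := hterm hf hl
      rcases hD with hD | ⟨haX, hD⟩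
      · exact (hYT hD haT).elim
      -- Leaving along an edge of `S` makes `a` a terminal, so its component is one of the merged
      -- ones and the first case applies.
      · have hr : ∃ r ∈ terminals G S, r ∉ X ∧ H.Reachable r a := ⟨a, haT, haX, .refl _⟩
        exact step₁ a b (huc.trans (hmem a hr hD)) haX hr hadj
    · refine Or.inr ⟨huc, Or.inr ⟨hbX, ?_⟩⟩
      rcases hD with hD | ⟨haX, y, hy, a', ha', hra, hl'⟩
      · exact ⟨a, hD, b, hbX, .refl _, f, hf, hl.symm⟩
      · exact ⟨y, hy, a', ha', hra.trans (reachable_of_isLink haX hbX hf hl), hl'⟩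
  have hinv : Inv v := by
    have h0 : Inv u := Or.inl ⟨huX, Relation.EqvGen.refl _, u, hu, huX, .refl _⟩
    have hwalk : ∀ {a b}, (restrictedGraph G (X \ Y ∪ Z) {e}ᶜ).Walk a b → Inv a → Inv b := by
      intro a b p
      induction p with
      | nil => exact id
      | cons hadj _ ih => exact fun ha => ih (step _ _ ha hadj)
    exact h.elim fun p => hwalk p h0
  rcases hinv with ⟨-, h, -⟩ | ⟨huc, hD⟩
  · exact h
  · rcases hD with hD | ⟨-, hD⟩
    · exact (hYT hD hv).elim
    · exact huc.trans (hmem v ⟨v, hv, hvX, .refl _⟩ hD)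

/-- Every nonempty set of non-terminals of a dominant solution is adjacent to many components. -/
theorem IsDominantSolution.ncard_add_two_le [Finite α] [Finite β] (hS : S ⊆ E(G))
    (hX : IsDominantSolution G S k X) (hYX : Y ⊆ X) (hYT : Disjoint Y (terminals G S))
    (hY : Y.Nonempty) : Y.ncard + 2 ≤ (adjacentComponents G S X Y).ncard := by
  classical
  by_contra! hlt
  obtain ⟨y₀, hy₀⟩ := hY
  have hex : ∀ e, ∃ u v, e ∈ S → G.IsLink e u v := by
    intro e
    by_cases he : e ∈ S
    · obtain ⟨u, v, h⟩ := G.exists_isLink_of_mem_edgeSet (hS he)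
      exact ⟨u, v, fun _ => h⟩
    · exact ⟨y₀, y₀, fun h => absurd h he⟩
  choose s t hst using hex
  set H := restrictedGraph G X Sᶜ with hH
  -- `c` represents one adjacent component and `C` the others, so `C` has at most `|Y|` elements.
  -- Without adjacent components, `y₀` is a dummy for `c`.
  obtain ⟨c, C, hC, hcC⟩ : ∃ (c : α) (C : Set α),
      C.ncard ≤ (adjacentComponents G S X Y).ncard - 1 ∧
      ∀ D ∈ adjacentComponents G S X Y, ∃ d, H.connectedComponentMk d = D ∧ (d = c ∨ d ∈ C) := by
    obtain hN | ⟨D₀, hD₀⟩ := (adjacentComponents G S X Y).eq_empty_or_nonempty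
    · exact ⟨y₀, ∅, by simp, by simp [hN]⟩
    · choose rep hrep using fun D : H.ConnectedComponent => D.exists_rep
      refine ⟨rep D₀, rep '' (adjacentComponents G S X Y \ {D₀}), ?_, fun D hD => ?_⟩
      · refine (Set.ncard_image_le (Set.toFinite _)).trans ?_
        rw [Set.ncard_sdiff_singleton_of_mem hD₀]
      · refine ⟨rep D, hrep D, ?_⟩
        by_cases h : D = D₀
        · exact Or.inl (by rw [h])
        · exact Or.inr ⟨D, ⟨hD, h⟩, rfl⟩
  obtain ⟨F, hF, hcard, hac⟩ :=
    (hX.isSolution.edgeAcyclic hst).exists_merge (Set.toFinite _) c C (Set.toFinite _)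
  set F₀ := {e ∈ S | s e ∉ X ∧ t e ∉ X} with hF₀
  -- One endpoint of each edge given up in the merge; these are terminals outside `X`, at most `|Y|`
  -- of them.
  set Z := s '' (F₀ \ F) with hZ
  have hZT : Z ⊆ terminals G S := by
    rintro _ ⟨e, ⟨he, -⟩, rfl⟩
    exact ⟨e, he.1, (hst e he.1).inc_left⟩
  have hZX : Disjoint Z X := by
    rw [Set.disjoint_left]
    rintro _ ⟨e, ⟨he, -⟩, rfl⟩
    exact he.2.1
  have hYpos : 0 < Y.ncard := Set.ncard_pos (Set.toFinite _) |>.2 ⟨y₀, hy₀⟩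
  have hZcard : Z.ncard ≤ Y.ncard := by
    have : Z.ncard ≤ (F₀ \ F).ncard := Set.ncard_image_le (Set.toFinite _)
    omega
  have hXY : (X \ Y).ncard + Y.ncard = X.ncard := Set.ncard_sdiff_add_ncard_of_subset hYX
  have hcardX : (X \ Y ∪ Z).ncard ≤ X.ncard := by
    have := Set.ncard_union_le (X \ Y) Z
    omega
  have hsol : IsSolution G S k (X \ Y ∪ Z) := by
    refine .of_not_reachable ?_ (Set.toFinite _) (hcardX.trans hX.isSolution.card_le) ?_
    · refine Set.union_subset (Set.sdiff_subset.trans hX.isSolution.subset) fun z hz => ?_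
      obtain ⟨e, -, he⟩ := hZT hz
      exact he.vertex_mem
    · intro e he u v hl hu hv hr
      have key : ∀ {a b}, G.IsLink e a b → a ∉ X \ Y ∪ Z → a ∈ terminals G S ∧ a ∉ X ∧ a ∉ Z := by
        intro a b hl ha
        have haT : a ∈ terminals G S := ⟨e, he, hl.inc_left⟩
        exact ⟨haT, fun h => ha (Or.inl ⟨h, fun h' => Set.disjoint_left.1 hYT h' haT⟩),
          fun h => ha (Or.inr h)⟩
      obtain ⟨huT, huX, huZ⟩ := key hl hu
      obtain ⟨hvT, hvX, hvZ⟩ := key hl.symm hv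
      have hmemF : ∀ f ∈ S, s f ∉ X → t f ∉ X → s f ∉ Z → f ∈ F := by
        intro f hf hsX htX hsZ
        by_contra hfF
        exact hsZ ⟨f, ⟨⟨hf, hsX, htX⟩, hfF⟩, rfl⟩
      have hcon := edgeConn_of_reachable_exchange (F := F \ {e}) (c := c) hst hYT
        (R := fun u v => H.Adj u v ∨ (u = c ∧ v ∈ C)) (fun a b h => Or.inl h) ?_
        (fun f hf hne h1 h2 h3 _ => ⟨hmemF f hf h1 h2 h3, hne⟩) huT hvT huX hvX hr
      · rcases hl.eq_and_eq_or_eq_and_eq (hst e he) with ⟨rfl, rfl⟩ | ⟨rfl, rfl⟩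
        · exact hac e (hmemF e he huX hvX huZ) hcon
        · exact hac e (hmemF e he hvX huX hvZ) hcon.symm
      · intro b hb
        obtain ⟨d, hd, hdC⟩ := hcC _ hb
        have hdb : EdgeConn s t (fun u v => H.Adj u v ∨ (u = c ∧ v ∈ C)) ∅ d b :=
          .of_reachable (fun _ _ h => Or.inl h) (SimpleGraph.ConnectedComponent.exact hd)
        rcases hdC with rfl | hdC
        · exact hdb
        · exact EdgeConn.trans (EdgeConn.of_rel (Or.inr ⟨rfl, hdC⟩)) hdb
  -- Minimality forces `|Z| ≥ |Y| > 0`, but the new solution has `|Z|` more terminals than `X`.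
  have hmin := hX.min_card _ hsol
  have hmax := hX.max_terminals _ hsol (le_antisymm hcardX hmin)
  have hunion := Set.ncard_union_le (X \ Y) Z
  have hT : (X \ Y ∪ Z) ∩ terminals G S = X ∩ terminals G S ∪ Z := by
    ext v
    have h1 := @hZT v
    have h2 : v ∈ Y → v ∉ terminals G S := fun h => Set.disjoint_left.1 hYT h
    simp only [Set.mem_inter_iff, Set.mem_union, Set.mem_sdiff]
    tauto
  rw [hT, Set.ncard_union_eq (hZX.symm.mono_left Set.inter_subset_left)] at hmax
  omega

end Exchange
end SubsetFVS
namespace SubsetFVS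

/-! ### From Hall's theorem to linked sets, and the obstruction outside `X`. -/

section Linkage

variable {α β : Type*}

/-- The vertex of `G` that a vertex of `G₁` is, or is a copy of. -/
def Copies.base : Copies α → α
  | .orig v => v
  | .copy₁ v => v
  | .copy₂ v => v

variable {G : Graph α β} {S : Set β} {X : Set α} {k : ℕ}

theorem deleteEdges_adj_iff {u v : α} :
    (G.deleteEdges S).Adj u v ↔ ∃ e ∉ S, G.IsLink e u v := by
  simp [Graph.Adj, and_comm]

theorem digraph₁_adj_of_isLink {a : α} {w : Copies α} {e : β} (he : e ∉ S)
    (h : G.IsLink e a w.base) : (digraph₁ G S).Adj (.orig a) w := by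
  have := deleteEdges_adj_iff.2 ⟨e, he, h⟩
  cases w <;> exact this

theorem notMem_of_reachable {F : Set β} {a b : α} (h : (restrictedGraph G X F).Reachable a b)
    (ha : a ∉ X) : b ∉ X := by
  obtain ⟨p⟩ := h
  induction p with
  | nil => exact ha
  | cons h _ ih => exact ih h.2.2.1

/-- A walk that meets `A` contains a path that starts in its last vertex in `A`. -/
theorem exists_isPath_from_last {H : SimpleGraph α} {A : Set α} {u a : α} (p : H.Walk u a)
    (h : ∃ v ∈ p.support, v ∈ A) :
    ∃ r ∈ A, ∃ q : H.Walk r a, q.IsPath ∧ ∀ v ∈ q.support, v ∈ A → v = r := by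
  classical
  induction p with
  | nil =>
    obtain ⟨v, hv, hvA⟩ := h
    simp only [SimpleGraph.Walk.support_nil, List.mem_singleton] at hv
    subst hv
    exact ⟨_, hvA, .nil, .nil, by simp⟩
  | @cons u v w hadj p ih =>
    by_cases hp : ∃ v ∈ p.support, v ∈ A
    · exact ih hp
    · push Not at hp
      obtain ⟨v', hv', hvA⟩ := h
      rw [SimpleGraph.Walk.support_cons, List.mem_cons] at hv'
      obtain rfl | hv' := hv'
      swap
      · exact absurd hvA (hp _ hv')
      refine ⟨_, hvA, (SimpleGraph.Walk.cons hadj p).bypass,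
        SimpleGraph.Walk.bypass_isPath _, fun b hb hbA => ?_⟩
      have := SimpleGraph.Walk.support_bypass_subset_support _ hb
      rw [SimpleGraph.Walk.support_cons, List.mem_cons] at this
      exact this.resolve_right fun h => hp _ h hbA

/-- A vertex adjacent to a component of `G - S - X` that contains terminals is reached by a path
whose other vertices are in the component, with only the first one a terminal. -/
theorem exists_dirPath {C : (restrictedGraph G X Sᶜ).ConnectedComponent} {w : Copies α}
    (hC : C ∈ adjacentComponents G S X {w.base}) (hw : ∀ v ∉ X, w ≠ .orig v) :
    ∃ r ∈ terminals G S, r ∉ X ∧ (restrictedGraph G X Sᶜ).connectedComponentMk r = C ∧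
      ∃ p, IsDirPath (digraph₁ G S) p (.orig r) w ∧ ∀ b ∈ p, b = w ∨ ∃ v, b = .orig v ∧ v ∉ X ∧
        (restrictedGraph G X Sᶜ).connectedComponentMk v = C ∧ (v ∈ terminals G S → v = r) := by
  obtain ⟨⟨r₀, hr₀, -, hr₀C⟩, y, rfl, a, ha, haC, e, he, hl⟩ := hC
  obtain ⟨p₀⟩ := SimpleGraph.ConnectedComponent.exact (hr₀C.trans haC.symm)
  obtain ⟨r, hr, q, hq, hqT⟩ := exists_isPath_from_last p₀ ⟨r₀, p₀.start_mem_support, hr₀⟩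
  have hmem : ∀ v ∈ q.support, (restrictedGraph G X Sᶜ).Reachable a v := fun v hv => by
    classical exact (q.dropUntil v hv).reachable.symm
  refine ⟨r, hr, notMem_of_reachable q.reachable.symm ha,
    (SimpleGraph.ConnectedComponent.sound q.reachable).trans haC,
    q.support.map .orig ++ [w], ⟨?_, ?_, ?_, ?_⟩, ?_⟩
  · rw [List.isChain_append]
    refine ⟨?_, by simp, ?_⟩
    · rw [List.isChain_map]
      refine q.isChain_adj_support.imp fun u v h => ?_
      obtain ⟨-, -, -, f, hf, hfl⟩ := h
      exact digraph₁_adj_of_isLink (w := .orig v) hf hfl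
    · intro u hu v hv
      rw [List.getLast?_map, List.getLast?_eq_some_getLast q.support_ne_nil, q.getLast_support] at hu
      simp only [Option.map_some, Option.mem_some_iff, List.head?_cons] at hu hv
      subst hu hv
      exact digraph₁_adj_of_isLink he hl
  · rw [List.nodup_append]
    refine ⟨hq.support_nodup.map fun u v h => by simpa using h, by simp, ?_⟩
    rintro u hu v hv rfl
    simp only [List.mem_map, List.mem_singleton] at hu hv
    obtain ⟨b, hb, rfl⟩ := hu
    exact hw b (notMem_of_reachable (hmem b hb) ha) hv.symm
  · rw [List.head?_append, List.head?_map, List.head?_eq_some_head q.support_ne_nil, q.head_support]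
    rfl
  · simp
  · intro b hb
    rw [List.mem_append, List.mem_singleton, List.mem_map] at hb
    obtain ⟨v, hv, rfl⟩ | rfl := hb
    · exact Or.inr ⟨v, rfl, notMem_of_reachable (hmem v hv) ha,
        (SimpleGraph.ConnectedComponent.sound (hmem v hv).symm).trans haC, hqT v hv⟩
    · exact Or.inl rfl

/-- Hall's theorem gives distinct components for the non-terminals of a dominant solution and the
two copies of one of them. -/
theorem IsDominantSolution.exists_components [Finite α] [Finite β] (hS : S ⊆ E(G))
    (hX : IsDominantSolution G S k X) {x : α} (hx : x ∈ X \ terminals G S) :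
    ∃ f : ↥(Copies.orig '' (X \ terminals G S) ∪ {Copies.copy₁ x, Copies.copy₂ x}) →
        (restrictedGraph G X Sᶜ).ConnectedComponent,
      Function.Injective f ∧ ∀ w, f w ∈ adjacentComponents G S X {w.1.base} := by
  classical
  set W : Set (Copies α) := Copies.orig '' (X \ terminals G S) ∪ {Copies.copy₁ x, Copies.copy₂ x}
  have hbase : ∀ w ∈ W, w.base ∈ X \ terminals G S := by
    rintro w (⟨v, hv, rfl⟩ | rfl | rfl)
    · exact hv
    · exact hx
    · exact hx
  have hall := (Finset.all_card_le_biUnion_card_iff_exists_injective fun w : W =>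
    (Set.toFinite (adjacentComponents G S X {w.1.base})).toFinset).1 ?_
  · obtain ⟨f, hf, hf'⟩ := hall
    exact ⟨f, hf, fun w => by simpa using hf' w⟩
  intro A
  obtain rfl | ⟨w₀, hw₀⟩ := A.eq_empty_or_nonempty
  · simp
  set Y : Set α := (fun w : W => w.1.base) '' A with hY
  have hYX : Y ⊆ X \ terminals G S := by
    rintro _ ⟨w, -, rfl⟩
    exact hbase w w.2
  have h1 := hX.ncard_add_two_le hS (hYX.trans Set.sdiff_subset)
    (Set.disjoint_left.2 fun v hv => (hYX hv).2) ⟨_, w₀, hw₀, rfl⟩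
  have h2 : (adjacentComponents G S X Y).ncard ≤ (A.biUnion fun w : W =>
      (Set.toFinite (adjacentComponents G S X {w.1.base})).toFinset).card := by
    rw [← Set.ncard_coe_finset]
    refine Set.ncard_le_ncard ?_ (Set.toFinite _)
    rintro D ⟨hD, _, ⟨w, hw, rfl⟩, hD'⟩
    simp only [Finset.coe_biUnion, Set.Finite.coe_toFinset, Set.mem_iUnion]
    exact ⟨w, hw, hD, _, rfl, hD'⟩
  -- The two copies of `x` account for the `+ 2` that the exchange argument provides.
  have h3 : A.card ≤ Y.ncard + 2 := by
    have hsub : (Subtype.val '' (A : Set W)) ⊆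
        Copies.orig '' Y ∪ {Copies.copy₁ x, Copies.copy₂ x} := by
      rintro _ ⟨⟨w, hw⟩, hwA, rfl⟩
      obtain ⟨v, hv, rfl⟩ | hw' := hw
      · exact Or.inl ⟨v, ⟨_, hwA, rfl⟩, rfl⟩
      · exact Or.inr hw'
    have h4 := Set.ncard_le_ncard hsub (Set.toFinite _)
    rw [Set.ncard_image_of_injective _ Subtype.val_injective, Set.ncard_coe_finset] at h4
    have h5 := Set.ncard_union_le (Copies.orig '' Y) {Copies.copy₁ x, Copies.copy₂ x}
    have h6 : (Copies.orig '' Y).ncard ≤ Y.ncard := Set.ncard_image_le (Set.toFinite _)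
    have h7 : ({Copies.copy₁ x, Copies.copy₂ x} : Set (Copies α)).ncard ≤ 2 :=
      (Set.ncard_insert_le _ _).trans (by simp)
    omega
  omega

/-- `R` collects the starting points of paths through distinct components. Only the first vertex of
such a path outside `X` is a terminal, so the paths also avoid the trivial paths at the remaining
terminals. -/
theorem IsDominantSolution.exists_isLinked [Finite α] [Finite β] (hS : S ⊆ E(G))
    (hX : IsDominantSolution G S k X) {x : α} (hx : x ∈ X \ terminals G S) :
    ∃ R ⊆ terminals G S, Disjoint R X ∧ R.ncard = (X \ terminals G S).ncard + 2 ∧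
      (∀ r ∈ R, ∀ r' ∈ R, (restrictedGraph G X Sᶜ).Reachable r r' → r = r') ∧
      IsLinked (digraph₁ G S) (.orig '' terminals G S)
        (.orig '' (X ∪ (terminals G S \ R)) ∪ {.copy₁ x, .copy₂ x}) := by
  classical
  obtain ⟨f, hf, hfC⟩ := hX.exists_components hS hx
  set W : Set (Copies α) := Copies.orig '' (X \ terminals G S) ∪ {Copies.copy₁ x, Copies.copy₂ x}
    with hW
  have hWX : ∀ w ∈ W, ∀ v ∉ X, w ≠ .orig v := by
    rintro w (⟨v, hv, rfl⟩ | rfl | rfl) v' hv' h <;> cases h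
    exact hv' hv.1
  choose r hrT hrX hrC p hp hpC using fun w : W => exists_dirPath (hfC w) (hWX w w.2)
  have hrinj : Function.Injective r := fun w w' h => hf (by rw [← hrC w, ← hrC w', h])
  refine ⟨Set.range r, Set.range_subset_iff.2 hrT, ?_, ?_, ?_, ?_⟩
  · rw [Set.disjoint_left]
    rintro _ ⟨w, rfl⟩
    exact hrX w
  · rw [← Set.image_univ, Set.ncard_image_of_injective _ hrinj, Set.ncard_univ]
    change W.ncard = _
    rw [hW, Set.ncard_union_eq, Set.ncard_image_of_injective, Set.ncard_pair]
    · simp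
    · intro u v h; simpa using h
    · rw [Set.disjoint_left]
      rintro _ ⟨v, -, rfl⟩
      simp
  · rintro _ ⟨w, rfl⟩ _ ⟨w', rfl⟩ h
    congr 1
    apply hf
    rw [← hrC w, ← hrC w']
    exact SimpleGraph.ConnectedComponent.sound h
  · have hJ : ∀ b ∈ (.orig '' (X ∪ (terminals G S \ Set.range r)) ∪ {.copy₁ x, .copy₂ x} :
        Set (Copies α)), b ∉ W → ∃ t ∈ terminals G S, t ∉ Set.range r ∧ b = .orig t := by
      rintro b (⟨v, hv, rfl⟩ | hb) hbW
      · obtain hv | hv := hv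
        · have hvT : v ∈ terminals G S := by
            by_contra h
            exact hbW (Or.inl ⟨v, ⟨hv, h⟩, rfl⟩)
          refine ⟨v, hvT, ?_, rfl⟩
          rintro ⟨w, rfl⟩
          exact hrX w hv
        · exact ⟨v, hv.1, hv.2, rfl⟩
      · exact absurd (Or.inr hb) hbW
    have hWT : ∀ (w : W) (t : α), t ∈ terminals G S → t ∉ Set.range r → Copies.orig t ∉ W →
        Copies.orig t ∉ p w := by
      intro w t ht htr htW hm
      obtain h | ⟨v, hv, -, -, hvr⟩ := hpC w _ hm
      · exact htW (h ▸ w.2)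
      · cases hv
        exact htr ⟨w, (hvr ht).symm⟩
    refine ⟨fun b => if h : b ∈ W then p ⟨b, h⟩ else [b], ?_, ?_⟩
    · intro b hb
      by_cases hbW : b ∈ W
      · simp only [hbW, dif_pos]
        exact ⟨_, ⟨_, hrT ⟨b, hbW⟩, rfl⟩, hp ⟨b, hbW⟩⟩
      · simp only [hbW, dif_neg, not_false_eq_true]
        obtain ⟨t, ht, -, rfl⟩ := hJ b hb hbW
        exact ⟨_, ⟨t, ht, rfl⟩, ⟨by simp, by simp, by simp, by simp⟩⟩
    · intro b hb b' hb' hne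
      by_cases hbW : b ∈ W <;> by_cases hbW' : b' ∈ W <;>
        simp only [hbW, hbW', dif_pos, dif_neg, not_false_eq_true]
      · intro c hc hc'
        obtain h | ⟨v, hv, hvX, hvC, -⟩ := hpC _ c hc <;>
        obtain h' | ⟨v', hv', hvX', hvC', -⟩ := hpC _ c hc'
        · exact hne (h.symm.trans h')
        · exact hWX b hbW v' hvX' (h.symm.trans hv')
        · exact hWX b' hbW' v hvX (h'.symm.trans hv)
        · rw [hv] at hv'
          cases hv'
          exact hne (Subtype.ext_iff.1 (hf (hvC.symm.trans hvC')))
      · obtain ⟨t, ht, htr, rfl⟩ := hJ b' hb' hbW'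
        simpa using hWT _ t ht htr hbW'
      · obtain ⟨t, ht, htr, rfl⟩ := hJ b hb hbW
        simpa using hWT _ t ht htr hbW
      · simpa using hne.symm

/-- Copies are sinks, so all vertices before the last are original ones and the path projects to a
walk in `G - S - X`. -/
theorem reachable_of_isChain {v : α} (hv : v ∉ X) {w : Copies α}
    (hw : w = .copy₁ v ∨ w = .copy₂ v) :
    ∀ (p : List (Copies α)) (a : α), p.IsChain (digraph₁ G S).Adj → p.head? = some (.orig a) →
      p.getLast? = some w → (∀ b, .orig b ∈ p → b ∉ X) →
      (restrictedGraph G X Sᶜ).Reachable a v := by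
  intro p
  induction p with
  | nil => intro a _ h; simp at h
  | cons c p ih =>
    intro a hch hhead hlast hX
    simp only [List.head?_cons, Option.some.injEq] at hhead
    subst hhead
    have haX := hX a List.mem_cons_self
    match p with
    | [] =>
      simp only [List.getLast?_singleton, Option.some.injEq] at hlast
      subst hlast
      simp at hw
    | .orig b :: p =>
      rw [List.isChain_cons_cons] at hch
      obtain ⟨e, he, hl⟩ := deleteEdges_adj_iff.1 hch.1
      refine (reachable_of_isLink haX (hX b (by simp)) he hl).trans
        (ih b hch.2 rfl (by simpa using hlast) fun b hb => hX b (List.mem_cons_of_mem _ hb))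
    | [.copy₁ u] =>
      simp only [List.getLast?_cons_cons, List.getLast?_singleton, Option.some.injEq] at hlast
      obtain rfl : u = v := by subst hlast; simpa using hw
      obtain ⟨e, he, hl⟩ := deleteEdges_adj_iff.1 (List.isChain_cons_cons.1 hch).1
      exact reachable_of_isLink haX hv he hl
    | [.copy₂ u] =>
      simp only [List.getLast?_cons_cons, List.getLast?_singleton, Option.some.injEq] at hlast
      obtain rfl : u = v := by subst hlast; simpa using hw
      obtain ⟨e, he, hl⟩ := deleteEdges_adj_iff.1 (List.isChain_cons_cons.1 hch).1
      exact reachable_of_isLink haX hv he hl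
    | .copy₁ u :: d :: p =>
      rw [List.isChain_cons_cons, List.isChain_cons_cons] at hch
      exact hch.2.1.elim
    | .copy₂ u :: d :: p =>
      rw [List.isChain_cons_cons, List.isChain_cons_cons] at hch
      exact hch.2.1.elim

/-- If each component of `G - S - X` has at most one terminal in `R`, then two copies of a vertex
outside `X` are not linked to the sources that `X` and the other terminals leave free. -/
theorem not_isLinked {R : Set α} {v : α} (hv : v ∉ X)
    (hR : ∀ r ∈ R, ∀ r' ∈ R, (restrictedGraph G X Sᶜ).Reachable r r' → r = r') :
    ¬ IsLinked (digraph₁ G S) (.orig '' terminals G S)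
        (.orig '' (X ∪ (terminals G S \ R)) ∪ {.copy₁ v, .copy₂ v}) := by
  rintro ⟨p, hp, hd⟩
  have key : ∀ w : Copies α, (w = .copy₁ v ∨ w = .copy₂ v) →
      ∃ r ∈ R, .orig r ∈ p w ∧ (restrictedGraph G X Sᶜ).Reachable r v := by
    intro w hw
    have hwJ : w ∈ (.orig '' (X ∪ (terminals G S \ R)) ∪ {.copy₁ v, .copy₂ v} : Set (Copies α)) :=
      Or.inr hw
    obtain ⟨_, ⟨r, hr, rfl⟩, hP⟩ := hp w hwJ
    -- Each target `b` lies on its own path, hence not on the one to `w`. So that path avoids `X`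
    -- and starts in `R`.
    have havoid : ∀ b, .orig b ∈ p w → b ∉ X ∪ (terminals G S \ R) := by
      intro b hb hbX
      have hbJ : Copies.orig b ∈ (.orig '' (X ∪ (terminals G S \ R)) ∪ {.copy₁ v, .copy₂ v} :
        Set (Copies α)) := Or.inl ⟨b, hbX, rfl⟩
      obtain ⟨_, -, hP'⟩ := hp _ hbJ
      refine hd w hwJ _ hbJ ?_ hb (List.mem_of_getLast? hP'.last)
      rintro rfl
      simp at hw
    have hrp : .orig r ∈ p w := List.mem_of_head? hP.head
    refine ⟨r, ?_, hrp, reachable_of_isChain hv hw _ _ hP.chain hP.head hP.last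
      fun b hb h => havoid b hb (Or.inl h)⟩
    by_contra h
    exact havoid r hrp (Or.inr ⟨hr, h⟩)
  obtain ⟨r, hr, hrp, hrv⟩ := key _ (Or.inl rfl)
  obtain ⟨r', hr', hrp', hrv'⟩ := key _ (Or.inr rfl)
  obtain rfl := hR r hr r' hr' (hrv.trans hrv'.symm)
  exact hd _ (by simp) _ (by simp) (by simp) hrp hrp'

end Linkage

theorem isLinked_digraph₂ {α β : Type*} [Finite α] {G : Graph α β} {k : ℕ} {A : Set α}
    (hA : A ⊆ V(G)) (hk : A.ncard ≤ k) :
    IsLinked (digraph₂ G k) (Set.range .inl) (.inr '' A) := by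
  classical
  obtain ⟨g, hg⟩ : ∃ g : A → Fin k, Function.Injective g := by
    have := Fintype.ofFinite A
    have h : Fintype.card A ≤ Fintype.card (Fin k) := by
      rwa [Fintype.card_fin, ← Nat.card_eq_fintype_card]
    obtain ⟨g⟩ := Function.Embedding.nonempty_of_card_le h
    exact ⟨g, g.injective⟩
  refine ⟨fun b => match b with
    | .inl _ => []
    | .inr v => if h : v ∈ A then [.inl (g ⟨v, h⟩), .inr v] else [], ?_, ?_⟩
  · rintro _ ⟨v, hv, rfl⟩
    refine ⟨_, ⟨g ⟨v, hv⟩, rfl⟩, ?_⟩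
    simp only [hv, dif_pos]
    exact ⟨by simpa [digraph₂] using hA hv, by simp, by simp, by simp⟩
  · rintro _ ⟨v, hv, rfl⟩ _ ⟨v', hv', rfl⟩ hne
    have hne' : v ≠ v' := fun h => hne (by rw [h])
    have hg' : g ⟨v, hv⟩ ≠ g ⟨v', hv'⟩ := fun h => hne' (Subtype.ext_iff.1 (hg h))
    simp [hv, hv', hg'.symm, hne'.symm]

end SubsetFVS
namespace SubsetFVS

/-! ### The extended set `I` and uniqueness of its extension. -/

section DirectSum

variable {α β : Type*} {G : Graph α β} {S : Set β} {k : ℕ}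

theorem preimage_inl_triple_union (v : α) (A : Set (Copies α)) (B : Set α) :
    .inl ⁻¹' (triple k v ∪ (.inl '' A ∪ .inr '' (.inr '' B))) = A ∪ {.copy₁ v, .copy₂ v} := by
  ext w
  simp only [triple, Set.mem_preimage, Set.mem_union, Set.mem_insert_iff, Set.mem_singleton_iff,
    Set.mem_image, Sum.inl.injEq, reduceCtorEq, and_false, exists_false, or_false,
    exists_eq_right]
  tauto

theorem preimage_inr_triple_union (v : α) (A : Set (Copies α)) (B : Set α) :
    .inr ⁻¹' (triple k v ∪ (.inl '' A ∪ .inr '' (.inr '' B))) = .inr '' insert v B := by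
  ext (w | w) <;> simp [triple, eq_comm]

/-- The direct sum extends a set of original vertices and of copies `v̂` by the triple of `v`
exactly if both parts do. -/
theorem directSumMatroid_indep_triple_union [Finite α] {v : α} {A : Set α} {B : Set α}
    (hv : v ∈ V(G)) (hA : A ⊆ V(G)) (hB : B ⊆ V(G)) (hk : (insert v B).ncard ≤ k) :
    (directSumMatroid G S k).Indep (triple k v ∪ (.inl '' (.orig '' A) ∪ .inr '' (.inr '' B))) ↔
      IsLinked (digraph₁ G S) (.orig '' terminals G S) (.orig '' A ∪ {.copy₁ v, .copy₂ v}) := by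
  have hvB : insert v B ⊆ V(G) := Set.insert_subset hv hB
  have hsub : (.orig '' A ∪ {.copy₁ v, .copy₂ v} : Set (Copies α)) ⊆
      .orig '' V(G) ∪ .copy₁ '' V(G) ∪ .copy₂ '' V(G) := by
    rintro w (⟨a, ha, rfl⟩ | rfl | rfl)
    · exact Or.inl (Or.inl ⟨a, hA ha, rfl⟩)
    · exact Or.inl (Or.inr ⟨v, hv, rfl⟩)
    · exact Or.inr ⟨v, hv, rfl⟩
  rw [directSumMatroid, Matroid.sum_indep_iff, preimage_inl_triple_union,
    preimage_inr_triple_union, matroid₁, matroid₂, gammoid_indep, gammoid_indep]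
  exact ⟨fun h => h.1.2, fun h => ⟨⟨hsub, h⟩, Set.image_mono hvB, isLinked_digraph₂ hvB hk⟩⟩

theorem IsDominantSolution.exists_uniquelyExtends [Finite α] [Finite β] (hS : S ⊆ E(G))
    {X : Set α} (hX : IsDominantSolution G S k X) {x : α} (hx : x ∈ X \ terminals G S) :
    ∃ I, (directSumMatroid G S k).Indep I ∧ I.ncard + 3 ≤ (terminals G S).ncard + k ∧
      UniquelyExtends (directSumMatroid G S k) (triples G k) (triple k x) I := by
  obtain ⟨R, hRT, hRX, hRcard, hR, hlink⟩ := hX.exists_isLinked hS hx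
  have hXV := hX.isSolution.subset
  have hTV : terminals G S ⊆ V(G) := by
    rintro v ⟨e, -, he⟩
    exact he.vertex_mem
  have hAV : X ∪ (terminals G S \ R) ⊆ V(G) :=
    Set.union_subset hXV (Set.sdiff_subset.trans hTV)
  have hBV : X \ {x} ⊆ V(G) := Set.sdiff_subset.trans hXV
  have hk := hX.isSolution.card_le
  set I : Set (Copies α ⊕ (Fin k ⊕ α)) :=
    .inl '' (.orig '' (X ∪ (terminals G S \ R))) ∪ .inr '' (.inr '' (X \ {x})) with hI
  have hind : (directSumMatroid G S k).Indep (triple k x ∪ I) := by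
    refine (directSumMatroid_indep_triple_union (hXV hx.1) hAV hBV ?_).2 hlink
    rwa [Set.insert_sdiff_self_of_mem hx.1]
  refine ⟨I, hind.subset Set.subset_union_right, ?_, ⟨x, hXV hx.1, rfl⟩, ⟨?_, hind⟩, ?_⟩
  · have h1 : I.ncard ≤ (X ∪ (terminals G S \ R)).ncard + (X \ {x}).ncard :=
      (Set.ncard_union_le _ _).trans (add_le_add
        ((Set.ncard_image_le (Set.toFinite _)).trans (Set.ncard_image_le (Set.toFinite _)))
        ((Set.ncard_image_le (Set.toFinite _)).trans (Set.ncard_image_le (Set.toFinite _))))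
    -- As `R` misses `X`, terminals of `X` are counted in `T \ R`. With `|R| = |X \ T| + 2` this
    -- part of `I` has size at most `|T| - 2`, and the hats add `|X| - 1`.
    have h2 : (X ∪ (terminals G S \ R)).ncard ≤
        (X \ terminals G S).ncard + (terminals G S \ R).ncard := by
      refine (Set.ncard_le_ncard ?_ (Set.toFinite _)).trans (Set.ncard_union_le _ _)
      rintro v (hv | hv)
      · by_cases hvT : v ∈ terminals G S
        · exact Or.inr ⟨hvT, fun h => Set.disjoint_left.1 hRX h hv⟩
        · exact Or.inl ⟨hv, hvT⟩
      · exact Or.inr hv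
    have h3 := Set.ncard_sdiff_add_ncard_of_subset hRT
    have h4 := Set.ncard_sdiff_singleton_add_one hx.1
    omega
  · rw [Set.disjoint_left]
    rintro _ (rfl | rfl | rfl) <;> simp [hI]
  · rintro _ ⟨v, hv, rfl⟩ ⟨hdisj, hvI⟩
    by_cases hvx : v = x
    · rw [hvx]
    have hvX : v ∉ X := by
      intro hvX
      have hvt : .inr (.inr v) ∈ triple k v := by simp [triple]
      refine Set.disjoint_left.1 hdisj hvt ?_
      exact Or.inr ⟨_, ⟨v, ⟨hvX, hvx⟩, rfl⟩, rfl⟩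
    -- Exchanging `x` for `v` keeps at most `k` hats, so the second summand is no obstacle; the
    -- first one is.
    refine (not_isLinked hvX hR ?_).elim
    refine (directSumMatroid_indep_triple_union hv hAV hBV ?_).1 hvI
    have h1 := Set.ncard_insert_le v (X \ {x})
    have h2 := Set.ncard_sdiff_singleton_add_one hx.1
    omega

end DirectSum

theorem UniquelyExtends.mem_of_isRepresentative {W : Type*} {M : Matroid W} {𝒜 𝒜' : Set (Set W)}
    {A I : Set W} {q : ℕ} (h : UniquelyExtends M 𝒜 A I) (hI : M.Indep I) (hq : I.ncard ≤ q)
    (hrep : IsRepresentative M q 𝒜 𝒜') : A ∈ 𝒜' := by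
  obtain ⟨A', hA', hext⟩ := (hrep.2 I hI hq).1 ⟨A, h.1, h.2.1⟩
  rwa [← h.2.2 A' (hrep.1 hA') hext]

end SubsetFVS

theorem mainTheorem7 {α β : Type*} [Finite α] [Finite β] (G : Graph α β) (S : Set β)
    (hS : S ⊆ E(G)) (k : ℕ) (X : Set α) (hX : SubsetFVS.IsDominantSolution G S k X)
    (x : α) (hx : x ∈ X \ SubsetFVS.terminals G S) :
    (∃ I : Set (SubsetFVS.Copies α ⊕ (Fin k ⊕ α)),
      (SubsetFVS.directSumMatroid G S k).Indep I ∧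
      I.ncard + 3 ≤ (SubsetFVS.terminals G S).ncard + k ∧
      SubsetFVS.UniquelyExtends (SubsetFVS.directSumMatroid G S k) (SubsetFVS.triples G k)
        (SubsetFVS.triple k x) I) ∧
    ∀ F : Set (Set (SubsetFVS.Copies α ⊕ (Fin k ⊕ α))),
      SubsetFVS.IsRepresentative (SubsetFVS.directSumMatroid G S k)
        ((SubsetFVS.terminals G S).ncard + k - 3) (SubsetFVS.triples G k) F →
      SubsetFVS.triple k x ∈ F := by
  obtain ⟨I, hI, hcard, huniq⟩ := hX.exists_uniquelyExtends hS hx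
  -- The bound `I.ncard + 3 ≤ |T| + k` ensures that the subtraction of `3` is not truncated.
  exact ⟨⟨I, hI, hcard, huniq⟩, fun F hF =>
    huniq.mem_of_isRepresentative hI (by omega) hF⟩
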